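/- A subset of a topological space is called a Cantor set if it is homeomorphic to the classical middle-thirds Cantor set. For a bounded set $A \subset \mathbb{R}$ and $\varepsilon > 0$ let $N(A,\varepsilon)$ be the least number of closed balls of radius $\varepsilon$ that cover $A$; the upper Minkowski dimension of $A$ is $\overline{\dim}_M A = \inf\{ s \ge 0 : N(A,\varepsilon)\,\varepsilon^s \to 0 \text{ as } \varepsilon \to 0^+ \}$, and the packing dimension of $A \subset \mathbb{R}$ is $\dim_p A = \inf\{ \sup_{i} \overline{\dim}_M A_i : A = \bigcup_{i \in \mathbb{N}} A_i,\ A_i \text{ bounded} \}$. Theorem. Let $K' \subset \mathbb{R}$ be a Cantor set with $\dim_p K' < 1$, and let $T \subset \mathbb{R}$ be a set with $|T| < \mathfrak{c}$, where $\mathfrak{c}$ is the cardinality of the continuum. Then the Minkowski sum $K' + T = \{k + t : k \in K',\ t \in T\}$ contains no Lebesgue measurable set of positive Lebesgue measure. -/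

import Mathlib

open Set Filter Topology MeasureTheory
open scoped ENNReal NNReal Pointwise

/-- A Cantor set: a set which, with the subspace topology, is homeomorphic to the classical
middle-thirds Cantor set. -/
def IsCantorSet {X : Type*} [TopologicalSpace X] (K : Set X) : Prop :=
  Nonempty (K ≃ₜ cantorSet)

/-- The upper Minkowski (box-counting) dimension: the infimum of all `s ≥ 0` such that
`N(A, ε) * ε ^ s → 0` as `ε → 0+`, where `N(A, ε)` is the least number of closed balls of
radius `ε` that cover `A`. It is `∞` if there is no such `s`. -/
noncomputable def upperMinkowskiDim {X : Type*} [PseudoMetricSpace X] (A : Set X) : ℝ≥0∞ :=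
  ⨅ (s : ℝ≥0) (_ : Tendsto
    (fun ε : ℝ≥0 => (Metric.externalCoveringNumber ε A : ℝ≥0∞) * (ε : ℝ≥0∞) ^ (s : ℝ))
    (𝓝[>] 0) (𝓝 0)), (s : ℝ≥0∞)

/-- The packing dimension: the infimum of `sup i, upperMinkowskiDim (F i)` over all
decompositions of `A` into countably many bounded sets `F i` (some of which may be empty). -/
noncomputable def packingDim {X : Type*} [PseudoMetricSpace X] (A : Set X) : ℝ≥0∞ :=
  ⨅ (F : ℕ → Set X) (_ : A = ⋃ i, F i) (_ : ∀ i, Bornology.IsBounded (F i)),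
    ⨆ i, upperMinkowskiDim (F i)

/-! Split `K` into countably many pieces `F i` whose covering numbers `N` satisfy `N ε^s → 0` with
one `s < 1`. If `s n + 1 ≤ n`, the `n`-tuples lying in one translate of `closure (F i)` by `|t| ≤ k`
form a null set: about `1/ε` translates times `N^n` cubes of volume `(4ε)^n` is at most a constant
times `(N ε^s)^n`. These sets are closed, so Baire category in `C(ℕ → Bool, A)`, with `A ⊆ P`
compact and of positive measure near each of its points, yields `f` whose values at `n` distinct
parameters never form such a tuple. Each `F i + t` then captures finitely many parameters, so `K +
T` captures fewer than continuum many, although `f` maps all of them into `P`. -/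

/-! ### Null sets of tuples meeting a translate of a set of small upper Minkowski dimension -/

/-- The `n`-tuples all of whose entries lie in one translate `K + t` with `|t| ≤ R`. -/
def translateTuples (n : ℕ) (K : Set ℝ) (R : ℝ) : Set (Fin n → ℝ) :=
  {x | ∃ t ∈ Icc (-R) R, ∀ j, x j - t ∈ K}

theorem isClosed_translateTuples (n : ℕ) {K : Set ℝ} (hK : IsClosed K) (R : ℝ) :
    IsClosed (translateTuples n K R) := by
  rw [← isOpen_compl_iff, isOpen_iff_eventually]
  intro x hx
  have h := (isCompact_Icc (a := -R) (b := R)).eventually_forall_of_forall_eventually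
    (x₀ := x) (P := fun (x : Fin n → ℝ) t => ¬ ∀ j, x j - t ∈ K) (by
      intro t ht
      have hc : IsClosed {z : (Fin n → ℝ) × ℝ | ∀ j, z.1 j - z.2 ∈ K} := by
        simp only [ofPred_forall]
        exact isClosed_iInter fun j => hK.preimage (by fun_prop)
      refine hc.isOpen_compl.mem_nhds ?_
      intro h
      exact hx ⟨t, ht, h⟩)
  filter_upwards [h] with y hy ⟨t, ht, hyt⟩
  exact hy t ht hyt

/-- Rounding `t` down to the grid `-R + kε` and each `x j - t` to a centre costs `ε` twice, hence
cubes of side `4ε`. -/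
theorem volume_translateTuples_le (n : ℕ) {K : Set ℝ} {R : ℝ} {ε : ℝ≥0} (hε : 0 < ε)
    {C : Finset ℝ} (hC : Metric.IsCover ε K C) :
    volume (translateTuples n K R) ≤
      ((⌊2 * R / ε⌋₊ + 1 : ℕ) : ℝ≥0∞) * (C.card : ℝ≥0∞) ^ n * (4 * ε : ℝ≥0∞) ^ n := by
  have hε' : (0 : ℝ) < ε := hε
  let I := Finset.range (⌊2 * R / ε⌋₊ + 1) ×ˢ Fintype.piFinset fun _ : Fin n => C
  have hsub : translateTuples n K R ⊆ ⋃ p ∈ I, Set.pi univ fun j =>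
      Metric.closedBall (p.2 j + (-R + p.1 * ε)) (2 * ε) := by
    rintro x ⟨t, ⟨ht₁, ht₂⟩, hx⟩
    choose c hc hd using fun j => hC (hx j)
    have h0 : 0 ≤ (t + R) / ε := div_nonneg (by linarith) hε'.le
    have hl₁ := Nat.floor_le h0
    have hl₂ := Nat.lt_floor_add_one ((t + R) / ε)
    rw [le_div_iff₀ hε'] at hl₁
    rw [div_lt_iff₀ hε'] at hl₂
    refine mem_iUnion₂.2 ⟨(⌊(t + R) / ε⌋₊, c), ?_, ?_⟩
    · simp only [I, Finset.mem_product, Finset.mem_range, Fintype.mem_piFinset]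
      refine ⟨Nat.lt_succ_of_le (Nat.floor_le_floor ?_), fun j => hc j⟩
      gcongr
      linarith
    · intro j _
      have h : dist (x j - t) (c j) ≤ ε := by
        have h : edist (x j - t) (c j) ≤ ε := hd j
        rwa [edist_nndist, ENNReal.coe_le_coe] at h
      rw [Real.dist_eq, abs_le] at h
      rw [Metric.mem_closedBall, Real.dist_eq, abs_le]
      constructor <;> linarith [h.1, h.2]
  refine (measure_mono hsub).trans ((measure_biUnion_finset_le _ _).trans ?_)
  have hvol : ∀ p ∈ I, volume (Set.pi univ fun j =>
      Metric.closedBall ((p : ℕ × (Fin n → ℝ)).2 j + (-R + p.1 * ε)) (2 * (ε : ℝ))) ≤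
        (4 * ε : ℝ≥0∞) ^ n := by
    intro p _
    rw [volume_pi_pi]
    simp only [Real.volume_closedBall, Finset.prod_const, Finset.card_univ, Fintype.card_fin]
    rw [← mul_assoc, ENNReal.ofReal_mul (by norm_num), ENNReal.ofReal_coe_nnreal]
    norm_num
  refine (Finset.sum_le_card_nsmul _ _ _ hvol).trans ?_
  simp [I, Finset.card_product, nsmul_eq_mul]

theorem volume_translateTuples_closure_eq_zero {n : ℕ} {A : Set ℝ} {s : ℝ≥0}
    (hs : Tendsto (fun ε : ℝ≥0 => (Metric.externalCoveringNumber ε A : ℝ≥0∞) *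
      (ε : ℝ≥0∞) ^ (s : ℝ)) (𝓝[>] 0) (𝓝 0))
    (hn : n ≠ 0) (hsn : (s : ℝ) * n + 1 ≤ n) {R : ℝ} (hR : 0 ≤ R) :
    volume (translateTuples n (closure A) R) = 0 := by
  have hlim := ENNReal.Tendsto.const_mul (ENNReal.Tendsto.pow (n := n) hs)
    (a := ENNReal.ofReal (2 * R + 1) * 4 ^ n) (Or.inr (by finiteness))
  rw [zero_pow hn, mul_zero] at hlim
  refine le_antisymm (ge_of_tendsto hlim ?_) bot_le
  have h1 : ∀ᶠ ε : ℝ≥0 in 𝓝[>] 0, ε ∈ Ioc 0 1 := Ioc_mem_nhdsGT one_pos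
  filter_upwards [h1, hs.eventually (gt_mem_nhds ENNReal.zero_lt_top)] with ε ⟨hε, hε1⟩ hfin
  have hN : Metric.externalCoveringNumber ε A ≠ ⊤ := by
    intro h
    rw [h] at hfin
    have : (ε : ℝ≥0∞) ^ (s : ℝ) ≠ 0 := (ENNReal.rpow_pos (by simpa using hε) (by simp)).ne'
    simp [ENNReal.top_mul this] at hfin
  obtain ⟨C, hC, hCcard⟩ : ∃ C : Set ℝ, Metric.IsCover ε A C ∧
      C.encard = Metric.externalCoveringNumber ε A := by
    have hne : Nonempty {C : Set ℝ // Metric.IsCover ε A C} := ⟨⟨A, .rfl⟩⟩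
    obtain ⟨⟨C, hC⟩, h⟩ := ENat.exists_eq_iInf
      fun C : {C : Set ℝ // Metric.IsCover ε A C} => C.1.encard
    exact ⟨C, hC, by rw [h, Metric.externalCoveringNumber, iInf_subtype]⟩
  have hCfin : C.Finite := by
    rw [← Set.encard_ne_top_iff, hCcard]; exact hN
  lift C to Finset ℝ using hCfin
  rw [Set.encard_coe_eq_coe_finsetCard] at hCcard
  -- A finite union of closed balls is closed, so passing to the closure costs nothing.
  refine (volume_translateTuples_le n hε (hC.closure C.finite_toSet.isClosed)).trans ?_
  rw [← hCcard]
  have hε0 : (ε : ℝ≥0∞) ≠ 0 := by simpa using hε.ne'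
  have hfloor : ((⌊2 * R / ε⌋₊ + 1 : ℕ) : ℝ≥0∞) * ε ≤ ENNReal.ofReal (2 * R + 1) := by
    rw [← ENNReal.ofReal_natCast, ← ENNReal.ofReal_coe_nnreal, ← ENNReal.ofReal_mul (by positivity)]
    apply ENNReal.ofReal_le_ofReal
    have hε' : (0 : ℝ) < ε := hε
    have h := Nat.floor_le (a := 2 * R / ε) (by positivity)
    rw [le_div_iff₀ hε'] at h
    have : (ε : ℝ) ≤ 1 := hε1
    push_cast
    linarith
  -- The spare factor `ε` pays for the number of translates.
  have hpow : (ε : ℝ≥0∞) ^ n ≤ ε * ((ε : ℝ≥0∞) ^ (s : ℝ)) ^ n := by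
    rw [← ENNReal.rpow_mul_natCast, ← ENNReal.rpow_natCast]
    nth_rewrite 2 [← ENNReal.rpow_one (ε : ℝ≥0∞)]
    rw [← ENNReal.rpow_add _ _ hε0 (by simp)]
    exact ENNReal.rpow_le_rpow_of_exponent_ge (by exact_mod_cast hε1) (by linarith)
  calc ((⌊2 * R / ε⌋₊ + 1 : ℕ) : ℝ≥0∞) * (C.card : ℝ≥0∞) ^ n * (4 * ε : ℝ≥0∞) ^ n
      ≤ ((⌊2 * R / ε⌋₊ + 1 : ℕ) : ℝ≥0∞) * (C.card : ℝ≥0∞) ^ n *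
        (4 ^ n * (ε * ((ε : ℝ≥0∞) ^ (s : ℝ)) ^ n)) := by
        rw [mul_pow]; gcongr
    _ = (((⌊2 * R / ε⌋₊ + 1 : ℕ) : ℝ≥0∞) * ε) * 4 ^ n *
        ((C.card : ℝ≥0∞) * (ε : ℝ≥0∞) ^ (s : ℝ)) ^ n := by ring
    _ ≤ _ := by
      gcongr
      simp

/-! ### Independent Cantor sets for null closed relations -/

/-- Selecting coordinates along an injective `τ` is a surjective linear map, so it pulls null sets
back to null sets; almost every point of the positive-measure box `∏ B σ` works. -/
theorem exists_forall_injective_notMem_of_null {n : ℕ} {ι : Type*} [Countable ι]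
    {E : ι → Set (Fin n → ℝ)} (hE : ∀ i, MeasurableSet (E i)) (hE0 : ∀ i, volume (E i) = 0)
    {S : Type*} [Fintype S] {B : S → Set ℝ} (hB : ∀ σ, 0 < volume (B σ)) :
    ∃ x : S → ℝ, (∀ σ, x σ ∈ B σ) ∧
      ∀ i (τ : Fin n → S), Function.Injective τ → x ∘ τ ∉ E i := by
  have hae : ∀ᵐ x : S → ℝ, ∀ i (τ : Fin n → S), Function.Injective τ → x ∘ τ ∈ (E i)ᶜ := by
    refine ae_all_iff.2 fun i => ae_all_iff.2 fun τ => ?_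
    by_cases hτ : Function.Injective τ
    · have hsurj : Function.Surjective (LinearMap.funLeft ℝ ℝ τ) :=
        LinearMap.funLeft_surjective_of_injective _ _ _ hτ
      have := (ae_comp_linearMap_mem_iff (LinearMap.funLeft ℝ ℝ τ) volume volume hsurj
        (hE i).compl).2 (measure_eq_zero_iff_ae_notMem.1 (hE0 i))
      filter_upwards [this] with x hx _ using hx
    · exact Eventually.of_forall fun x h => absurd h hτ
  have hpos : volume (Set.pi univ B) ≠ 0 := by
    rw [volume_pi_pi]
    exact Finset.prod_ne_zero_iff.2 fun σ _ => (hB σ).ne'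
  obtain ⟨x, hx, hx'⟩ := ((frequently_ae_mem_iff.2 hpos).and_eventually hae).exists
  exact ⟨x, fun σ => hx σ (mem_univ _), hx'⟩

/-- The first `m` entries of a binary sequence. -/
def binaryPrefix (m : ℕ) (c : ℕ → Bool) : Fin m → Bool := fun i => c i

/-- The extension of a finite binary word by zeros. -/
def zeroExtend (m : ℕ) (w : Fin m → Bool) : ℕ → Bool :=
  fun i => if h : i < m then w ⟨i, h⟩ else false

theorem continuous_binaryPrefix (m : ℕ) : Continuous (binaryPrefix m) := by
  unfold binaryPrefix; fun_prop

theorem exists_injective_binaryPrefix {n : ℕ} {c : Fin n → ℕ → Bool}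
    (hc : Function.Injective c) : ∃ m, Function.Injective fun j => binaryPrefix m (c j) := by
  have h : ∀ p : Fin n × Fin n, ∃ m, p.1 ≠ p.2 → c p.1 m ≠ c p.2 m := by
    intro p
    by_cases hp : p.1 = p.2
    · exact ⟨0, fun h => absurd hp h⟩
    · obtain ⟨m, hm⟩ := Function.ne_iff.1 (hc.ne hp)
      exact ⟨m, fun _ => hm⟩
  choose m hm using h
  refine ⟨Finset.univ.sup m + 1, fun i j hij => ?_⟩
  by_contra hne
  refine hm (i, j) hne ?_
  exact congrFun hij ⟨m (i, j), Nat.lt_succ_of_le (Finset.le_sup (Finset.mem_univ (i, j)))⟩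

theorem tendstoUniformly_comp_zeroExtend {X : Type*} [UniformSpace X] {f : (ℕ → Bool) → X}
    (hf : Continuous f) :
    TendstoUniformly (fun m c => f (zeroExtend m (binaryPrefix m c))) f atTop := by
  have hf' := CompactSpace.uniformContinuous_of_continuous hf
  refine hf'.comp_tendstoUniformly (F := fun m c => zeroExtend m (binaryPrefix m c)) (f := id) ?_
  rw [tendstoUniformly_iff_tendsto, Pi.uniformity, tendsto_iInf]
  refine fun i => tendsto_comap_iff.2 fun u hu => ?_
  have h : ∀ᶠ p : ℕ × (ℕ → Bool) in atTop ×ˢ ⊤, i < p.1 :=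
    tendsto_fst.eventually (eventually_gt_atTop i)
  refine mem_map.2 (h.mono fun p hp => ?_)
  simpa [zeroExtend, binaryPrefix, hp] using refl_mem_uniformity hu

/-- The continuous maps whose values at points with distinct prefixes of length `m` avoid `E`. -/
def avoidingMaps (A : Set ℝ) {n : ℕ} (E : Set (Fin n → ℝ)) (m : ℕ) : Set C(ℕ → Bool, A) :=
  {f | ∀ c ∈ {c : Fin n → ℕ → Bool | Function.Injective fun j => binaryPrefix m (c j)},
    (fun j => (f (c j) : ℝ)) ∉ E}

/-- Requiring distinct prefixes, rather than distinct points, makes the set of tuples `c` compact.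
-/
theorem isOpen_avoidingMaps (A : Set ℝ) {n : ℕ} {E : Set (Fin n → ℝ)} (hE : IsClosed E) (m : ℕ) :
    IsOpen (avoidingMaps A E m) := by
  rw [isOpen_iff_eventually]
  intro f hf
  have hD : IsClosed {c : Fin n → ℕ → Bool | Function.Injective fun j => binaryPrefix m (c j)} :=
    (isClosed_discrete {w : Fin n → Fin m → Bool | Function.Injective w}).preimage
      (f := fun (c : Fin n → ℕ → Bool) j => binaryPrefix m (c j))
      (continuous_pi fun j => (continuous_binaryPrefix m).comp (continuous_apply j))
  refine hD.isCompact.eventually_forall_of_forall_eventually fun c hc => ?_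
  have hcont : Continuous fun z : C(ℕ → Bool, A) × (Fin n → ℕ → Bool) =>
      fun j => (z.1 (z.2 j) : ℝ) := by fun_prop
  exact (hE.preimage hcont).isOpen_compl.mem_nhds (hf c hc)

/-- Approximate `f` by a map depending only on the `M`-prefix, then perturb its finitely many values
into general position. With `M ≥ m`, distinct `m`-prefixes have distinct `M`-prefixes. -/
theorem dense_avoidingMaps {A : Set ℝ}
    (hA : ∀ y ∈ A, ∀ r > 0, 0 < volume (A ∩ Metric.ball y r)) {n : ℕ} {E : Set (Fin n → ℝ)}
    (hE : MeasurableSet E) (hE0 : volume E = 0) (m : ℕ) : Dense (avoidingMaps A E m) := by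
  rw [Metric.dense_iff]
  intro f r hr
  have hu := Metric.tendstoUniformly_iff.1 (tendstoUniformly_comp_zeroExtend f.continuous)
    (r / 3) (by positivity)
  obtain ⟨M, hM, hmM⟩ := (hu.and (eventually_ge_atTop m)).exists
  obtain ⟨x, hx, hxE⟩ := exists_forall_injective_notMem_of_null (ι := Unit) (E := fun _ => E)
    (fun _ => hE) (fun _ => hE0)
    (fun w : Fin M → Bool => hA (f (zeroExtend M w)) (f (zeroExtend M w)).2 (r / 3) (by positivity))
  let g : C(ℕ → Bool, A) :=
    ⟨fun c => ⟨x (binaryPrefix M c), (hx _).1⟩,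
      (continuous_of_discreteTopology (f := fun w => (⟨x w, (hx w).1⟩ : A))).comp
        (continuous_binaryPrefix M)⟩
  refine ⟨g, ?_, ?_⟩
  · rw [Metric.mem_ball]
    refine ((ContinuousMap.dist_le (C := r / 3 + r / 3) (by positivity)).2 fun c => ?_).trans_lt
      (by linarith)
    refine (dist_triangle _ (f (zeroExtend M (binaryPrefix M c))) _).trans (add_le_add ?_ ?_)
    · exact (Metric.mem_ball.1 (hx (binaryPrefix M c)).2).le
    · rw [dist_comm]; exact (hM c).le
  · intro c hc
    refine hxE () (fun j => binaryPrefix M (c j)) fun i j hij => hc ?_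
    funext k
    exact congrFun hij ⟨k, k.2.trans_le hmM⟩

theorem exists_continuousMap_forall_injective_notMem {A : Set ℝ} (hAc : IsCompact A)
    (hAne : A.Nonempty) (hA : ∀ y ∈ A, ∀ r > 0, 0 < volume (A ∩ Metric.ball y r)) {n : ℕ}
    {ι : Type*} [Countable ι] {E : ι → Set (Fin n → ℝ)} (hE : ∀ i, IsClosed (E i))
    (hE0 : ∀ i, volume (E i) = 0) :
    ∃ f : (ℕ → Bool) → ℝ, (∀ c, f c ∈ A) ∧
      ∀ i (c : Fin n → ℕ → Bool), Function.Injective c → (fun j => f (c j)) ∉ E i := by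
  have : CompactSpace A := isCompact_iff_compactSpace.1 hAc
  have : Nonempty C(ℕ → Bool, A) := ⟨.const _ ⟨_, hAne.some_mem⟩⟩
  have hd : Dense (⋂ p : ι × ℕ, avoidingMaps A (E p.1) p.2) :=
    dense_iInter_of_isOpen (fun p => isOpen_avoidingMaps A (hE p.1) p.2)
      fun p => dense_avoidingMaps hA (hE p.1).measurableSet (hE0 p.1) p.2
  obtain ⟨f, hf⟩ := hd.nonempty
  refine ⟨fun c => f c, fun c => (f c).2, fun i c hc => ?_⟩
  obtain ⟨m, hm⟩ := exists_injective_binaryPrefix hc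
  exact mem_iInter.1 hf (i, m) c hm

/-! ### The main theorem -/

theorem exists_compact_subset_forall_ball_pos {P : Set ℝ} (hP : NullMeasurableSet P volume)
    (hpos : 0 < volume P) : ∃ A ⊆ P, IsCompact A ∧ A.Nonempty ∧
      ∀ y ∈ A, ∀ r > 0, 0 < volume (A ∩ Metric.ball y r) := by
  obtain ⟨P', hP'P, hP'm, hP'eq⟩ := hP.exists_measurable_subset_ae_eq
  obtain ⟨B, hBP, hBc, hB⟩ := hP'm.exists_lt_isCompact (μ := volume) (r := 0)
    (by rwa [measure_congr hP'eq])
  -- The support discards the portions of `B` that are locally null.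
  have hsub : (volume.restrict B).support ⊆ B :=
    (Measure.support_restrict_subset.trans inter_subset_left).trans_eq hBc.isClosed.closure_eq
  refine ⟨(volume.restrict B).support, hsub.trans (hBP.trans hP'P),
    hBc.of_isClosed_subset Measure.isClosed_support hsub,
    Measure.nonempty_support (Measure.restrict_eq_zero.not.2 hB.ne'), fun y hy r hr => ?_⟩
  have h := Measure.mem_support_iff_forall y |>.1 hy _ (Metric.ball_mem_nhds y hr)
  refine h.trans_le ?_
  rw [← measure_inter_conull (Measure.measure_compl_support (μ := volume.restrict B)), inter_comm]
  exact Measure.restrict_apply_le _ _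

theorem exists_cover_of_packingDim_lt_one {K : Set ℝ} (hK : packingDim K < 1) :
    ∃ (F : ℕ → Set ℝ) (s : ℝ≥0), K = ⋃ i, F i ∧ s < 1 ∧ ∀ i,
      Tendsto (fun ε : ℝ≥0 => (Metric.externalCoveringNumber ε (F i) : ℝ≥0∞) *
        (ε : ℝ≥0∞) ^ (s : ℝ)) (𝓝[>] 0) (𝓝 0) := by
  simp only [packingDim, iInf_lt_iff] at hK
  obtain ⟨F, hF, -, hlt⟩ := hK
  obtain ⟨s, hs, hs1⟩ := ENNReal.lt_iff_exists_nnreal_btwn.1 hlt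
  refine ⟨F, s, hF, by exact_mod_cast hs1, fun i => ?_⟩
  have hi := (le_iSup (fun i => upperMinkowskiDim (F i)) i).trans_lt hs
  simp only [upperMinkowskiDim, iInf_lt_iff] at hi
  obtain ⟨u, hu, hus⟩ := hi
  refine tendsto_of_tendsto_of_tendsto_of_le_of_le' tendsto_const_nhds hu
    (Eventually.of_forall fun _ => bot_le) ?_
  filter_upwards [Ioc_mem_nhdsGT (one_pos : (0 : ℝ≥0) < 1)] with ε hε
  gcongr 1
  exact ENNReal.rpow_le_rpow_of_exponent_ge (by exact_mod_cast hε.2)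
    (by exact_mod_cast hus.le)

theorem exists_nat_mul_add_one_le {s : ℝ≥0} (hs : s < 1) :
    ∃ n : ℕ, n ≠ 0 ∧ (s : ℝ) * n + 1 ≤ n := by
  have hs' : (0 : ℝ) < 1 - s := sub_pos.2 hs
  obtain ⟨n, hn⟩ := exists_nat_gt (1 / (1 - s : ℝ))
  have h := (div_lt_iff₀ hs').1 hn
  refine ⟨n, ?_, by linarith⟩
  rintro rfl
  simp at h
  linarith

theorem mainTheorem2 (K T : Set ℝ) (hK : IsCantorSet K) (hdim : packingDim K < 1)
    (hT : Cardinal.mk T < Cardinal.continuum) :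
    ∀ P : Set ℝ, P ⊆ K + T → NullMeasurableSet P volume → ¬ 0 < volume P := by
  intro P hPKT hP hpos
  obtain ⟨A, hAP, hAc, hAne, hA⟩ := exists_compact_subset_forall_ball_pos hP hpos
  obtain ⟨F, s, hKF, hs, hF⟩ := exists_cover_of_packingDim_lt_one hdim
  obtain ⟨n, hn, hsn⟩ := exists_nat_mul_add_one_le hs
  obtain ⟨f, hfA, hf⟩ := exists_continuousMap_forall_injective_notMem hAc hAne hA (n := n)
    (E := fun p : ℕ × ℕ => translateTuples n (closure (F p.1)) p.2)
    (fun p => isClosed_translateTuples n isClosed_closure _)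
    (fun p => volume_translateTuples_closure_eq_zero (hF p.1) hn hsn p.2.cast_nonneg)
  have hfin : ∀ (t : ℝ) (i : ℕ), {c | f c - t ∈ F i}.Finite := by
    intro t i
    by_contra hinf
    obtain ⟨k, hk⟩ := exists_nat_ge |t|
    have e := Set.Infinite.natEmbedding _ hinf
    refine hf (i, k) (fun j => e j) (fun a b hab => ?_)
      ⟨t, abs_le.1 hk, fun j => subset_closure (e j).2⟩
    exact Fin.val_injective (e.injective (Subtype.val_injective hab))
  have hcover : (univ : Set (ℕ → Bool)) ⊆ ⋃ t : T, ⋃ i, {c | f c - t ∈ F i} := by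
    intro c _
    obtain ⟨k, hk, t, ht, hkt⟩ := hPKT (hAP (hfA c))
    rw [hKF] at hk
    obtain ⟨i, hi⟩ := mem_iUnion.1 hk
    refine mem_iUnion.2 ⟨⟨t, ht⟩, mem_iUnion.2 ⟨i, ?_⟩⟩
    simpa [← hkt] using hi
  -- Each `t` accounts for only countably many parameters, so the bound is `|T| * ℵ₀` and regularity
  -- of the continuum is not needed.
  have hlt : Cardinal.mk (⋃ t : T, ⋃ i, {c | f c - t ∈ F i}) < Cardinal.continuum := by
    refine (Cardinal.mk_iUnion_le _).trans_lt ?_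
    refine Cardinal.mul_lt_of_lt Cardinal.aleph0_le_continuum hT
      (lt_of_le_of_lt ?_ Cardinal.aleph0_lt_continuum)
    exact ciSup_le' fun t => (countable_iUnion fun i => (hfin t i).countable).le_aleph0
  have h := (Cardinal.mk_le_mk_of_subset hcover).trans_lt hlt
  simp at h
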